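/- Let $\mathbb{T}=\{z\in\mathbb{C}: |z|=1\}$ and let $\mathbb{T}^\infty=\mathbb{T}\times\mathbb{T}\times\cdots$ be the countably infinite polytorus with its Haar probability measure $\mu_\infty$, the infinite product of the normalized arc length measures on $\mathbb{T}$. For $f\in L^2(\mathbb{T}^\infty)$ and a finitely supported multi-index $\alpha$ of integers, put $c_\alpha=\int_{\mathbb{T}^\infty} f(z)\,\overline{z^\alpha}\,d\mu_\infty(z)$, and define the Riesz projection of $f$ by $$Pf(z)=\sum_{\alpha\ge 0} c_\alpha z^\alpha,$$ where the sum runs over the finitely supported multi-indices with nonnegative entries and converges in $L^2(\mathbb{T}^\infty)$. Let $2\le p\le q\le\infty$ and $q^{-1}+r^{-1}=1$. If $$\Gamma\left(1+\frac p2\right)^{1/p}\,\Gamma\left(1+\frac r2\right)^{1/r}>1$$ (for $p=\infty$ the first factor is read as its limit $+\infty$, so that the condition holds), then the Riesz projection is unbounded from $L^q(\mathbb{T}^\infty)$ to $L^p(\mathbb{T}^\infty)$: there is no finite constant $C$ such that $\|Pf\|_{L^p(\mathbb{T}^\infty)}\le C\,\|f\|_{L^q(\mathbb{T}^\infty)}$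 for all $f\in L^q(\mathbb{T}^\infty)$, where $\|Pf\|_{L^p(\mathbb{T}^\infty)}=\infty$ if $Pf\notin L^p(\mathbb{T}^\infty)$. -/

import Mathlib

open MeasureTheory
open scoped ENNReal NNReal ComplexConjugate

noncomputable section

namespace Polytorus

/-- The unit circle `𝕋 = {z : |z| = 1}` carries its Borel sigma-algebra. -/
instance instMeasurableSpaceCircle : MeasurableSpace Circle := borel Circle

instance instBorelSpaceCircle : BorelSpace Circle := ⟨rfl⟩

/-- The Haar probability measure of `𝕋`, i.e. the normalized arc length measure. -/
def circleMeasure : Measure Circle :=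
  Measure.haarMeasure (⊤ : TopologicalSpace.PositiveCompacts Circle)

instance instIsProbabilityMeasureCircle : IsProbabilityMeasure circleMeasure :=
  ⟨by simpa [circleMeasure] using
    Measure.haarMeasure_self (K₀ := (⊤ : TopologicalSpace.PositiveCompacts Circle))⟩

instance instIsHaarMeasureCircle : circleMeasure.IsHaarMeasure :=
  inferInstanceAs (Measure.haarMeasure _).IsHaarMeasure

/-- The countably infinite polytorus `𝕋^∞ = 𝕋 × 𝕋 × ⋯`. -/
abbrev InfTorus : Type := ℕ → Circle

/-- The Haar measure `μ_∞` of `𝕋^∞`: the product of the normalized arc length measures. -/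
def haarInf : Measure InfTorus := Measure.infinitePi fun _ => circleMeasure

instance instIsProbabilityMeasureInf : IsProbabilityMeasure haarInf :=
  inferInstanceAs (IsProbabilityMeasure (Measure.infinitePi fun _ : ℕ => circleMeasure))

/-- The monomial `z^α = ∏_j z_j ^ α_j` for a finitely supported multi-index `α` of integers,
as a continuous function on `𝕋^∞`. -/
def monomial (α : ℕ →₀ ℤ) : C(InfTorus, ℂ) where
  toFun z := ((∏ j ∈ α.support, z j ^ α j : Circle) : ℂ)
  continuous_toFun := by fun_prop

/-- The Fourier coefficient `c_α = ∫ f(z) conj(z^α) dμ_∞(z)`. -/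
def fourierCoeff (f : InfTorus → ℂ) (α : ℕ →₀ ℤ) : ℂ :=
  ∫ z, f z * conj (monomial α z) ∂haarInf

/-- The monomial `z^α` as an element of `L²(𝕋^∞)`. -/
def monomialL2 (α : ℕ →₀ ℤ) : Lp ℂ 2 haarInf :=
  ContinuousMap.toLp 2 haarInf ℂ (monomial α)

/-- The multi-indices all of whose entries are nonnegative. -/
def nonnegIndices : Set (ℕ →₀ ℤ) := {α | ∀ j, 0 ≤ α j}

/-- The Riesz projection `P f = ∑_{α ≥ 0} c_α z^α` of a function `f` in `L²(𝕋^∞)`.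
The series converges unconditionally in `L²(𝕋^∞)`, see `hasSum_rieszProjection`. -/
def rieszProjection (f : InfTorus → ℂ) : Lp ℂ 2 haarInf :=
  ∑' α : nonnegIndices, fourierCoeff f α • monomialL2 α

/-- For `2 ≤ q`, the Riesz projection is bounded from `L^q(𝕋^∞)` (a subspace of `L²(𝕋^∞)`) to
`L^p(𝕋^∞)`: there is a constant `C` with `‖P f‖_p ≤ C ‖f‖_q` for all `f` in `L^q(𝕋^∞)`.
Here `‖P f‖_p = ∞` if `P f` is not in `L^p(𝕋^∞)`. -/
def RieszBounded (q p : ℝ≥0∞) : Prop :=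
  ∃ C : ℝ≥0, ∀ f : InfTorus → ℂ, MemLp f q haarInf →
    eLpNorm (rieszProjection f) p haarInf ≤ C * eLpNorm f q haarInf

/-- The quantity `Γ(1 + p/2)^{1/p}` for `0 < p < ∞`, and its limit `∞` for `p = ∞`. -/
def gammaRoot (p : ℝ≥0∞) : ℝ≥0∞ :=
  if p = ∞ then ∞ else ENNReal.ofReal (Real.Gamma (1 + p.toReal / 2) ^ (1 / p.toReal))

theorem map_mul_haarInf (w : InfTorus) : haarInf.map (fun z => w * z) = haarInf := by
  have h := Measure.infinitePi_map_pi (fun _ : ℕ => circleMeasure)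
    (f := fun i (x : Circle) => w i * x) (fun i => measurable_const_mul _)
  simp only [map_mul_left_eq_self] at h
  exact h

theorem monomial_mul (α : ℕ →₀ ℤ) (w z : InfTorus) :
    monomial α (w * z) = monomial α w * monomial α z := by
  simp [monomial, mul_zpow, Finset.prod_mul_distrib]

theorem conj_monomial_mul (α β : ℕ →₀ ℤ) (z : InfTorus) :
    conj (monomial α z) * monomial β z = monomial (β - α) z := by
  have h : ∀ γ : ℕ →₀ ℤ, monomial γ z = ((γ.prod fun j k => z j ^ k : Circle) : ℂ) :=
    fun γ => rfl
  rw [h, h, h, sub_eq_add_neg, Finsupp.prod_add_index' (by simp) (by simp [zpow_add]),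
    Finsupp.prod_neg_index (by simp), ← Circle.coe_inv_eq_conj, mul_comm]
  simp [Finsupp.prod]

theorem integral_monomial (α : ℕ →₀ ℤ) (hα : α ≠ 0) : ∫ z, monomial α z ∂haarInf = 0 := by
  obtain ⟨j, hj⟩ := Finsupp.ne_iff.1 hα
  have hj : α j ≠ 0 := by simpa using hj
  set w : InfTorus := Function.update 1 j (Circle.exp (Real.pi / α j)) with hw
  have h1 : monomial α w = -1 := by
    have : ∏ i ∈ α.support, w i ^ α i = Circle.exp (Real.pi / α j) ^ α j := by
      rw [Finset.prod_eq_single j]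
      · simp [hw]
      · intro b _ hb
        simp [hw, hb]
      · intro h
        simp [Finsupp.notMem_support_iff.1 h]
    have hne : (α j : ℂ) ≠ 0 := by exact_mod_cast hj
    show ((∏ i ∈ α.support, w i ^ α i : Circle) : ℂ) = -1
    rw [this, Circle.coe_zpow, Circle.coe_exp, ← Complex.exp_int_mul, ← Complex.exp_pi_mul_I]
    congr 1
    push_cast
    field_simp
  have h2 : ∫ z, monomial α z ∂haarInf = ∫ z, monomial α (w * z) ∂haarInf := by
    conv_lhs => rw [← map_mul_haarInf w]
    exact integral_map (by fun_prop) (monomial α).continuous.aestronglyMeasurable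
  simp only [monomial_mul, h1, integral_const_mul] at h2
  linear_combination h2 / 2

theorem orthonormal_monomialL2 : Orthonormal ℂ monomialL2 := by
  classical
  rw [orthonormal_iff_ite]
  intro α β
  rw [monomialL2, monomialL2, ContinuousMap.inner_toLp]
  have : ∀ z, monomial β z * conj (monomial α z) = monomial (β - α) z := fun z => by
    rw [mul_comm, conj_monomial_mul]
  simp only [this]
  split_ifs with h
  · subst h
    simp [monomial]
  · exact integral_monomial _ (sub_ne_zero.2 (Ne.symm h))

theorem inner_monomialL2 (f : InfTorus → ℂ) (hf : MemLp f 2 haarInf) (α : ℕ →₀ ℤ) :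
    inner ℂ (monomialL2 α) (hf.toLp f) = fourierCoeff f α := by
  rw [L2.inner_def, fourierCoeff]
  refine integral_congr_ae ?_
  filter_upwards [hf.coeFn_toLp, ContinuousMap.coeFn_toLp (p := 2) (𝕜 := ℂ) haarInf (monomial α)]
    with z h1 h2
  rw [h1, monomialL2, h2, RCLike.inner_apply]

/-- For `f` in `L²(𝕋^∞)` the defining series of the Riesz projection converges. -/
theorem hasSum_rieszProjection (f : InfTorus → ℂ) (hf : MemLp f 2 haarInf) :
    HasSum (fun α : nonnegIndices => fourierCoeff f α • monomialL2 α) (rieszProjection f) := by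
  have ho : Orthonormal ℂ fun α : nonnegIndices => monomialL2 α :=
    orthonormal_monomialL2.comp _ Subtype.val_injective
  have h := (ho.orthogonalFamily.summable_iff_norm_sq_summable
    (fun α : nonnegIndices => fourierCoeff f α)).2 (by
      simpa only [inner_monomialL2 f hf] using ho.inner_products_summable (hf.toLp f))
  exact (by simpa using h : Summable _).hasSum

end Polytorus

end

/-! Let `S = (x₁ + ⋯ + x_d) / √d` on `𝕋^d` and test `P` on the Hölder extremal `f = |S|^(r-2) S`,
for which `‖f‖_q ≤ ‖S‖_r^(r-1)`. As `f` has degree one under the diagonal rotation, only frequencies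
of total degree one occur. The nonnegative ones are the coordinates, and by symmetry their
coefficients agree, so `P f = E|S|^r · S`. Hence `‖P f‖_p / ‖f‖_q ≥ ‖S‖_p ‖S‖_r`.

By the central limit theorem `S` tends in law to a standard complex Gaussian `Z`, with `E|Z|^p = Γ(1
+ p/2)`. A Fatou-type bound then makes `‖S‖_p ‖S‖_r > 1` for some `d`, by the hypothesis on `Γ`. The
product of `n` copies of `f` in disjoint blocks of variables raises the ratio to the power `n`, so
no constant works (`not_rieszBounded_of_one_lt`).

For `p = ∞` one has `q = ∞` and `r = 1`, and boundedness into `L^4` already fails. -/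

noncomputable section

namespace Polytorus

open Filter ProbabilityTheory
open scoped Topology

/-! ### Moments and characteristic function of the complex Gaussian -/

/-- The standard complex Gaussian distribution, with density `exp (-|z|²) / π`. -/
def complexGaussian : Measure ℂ :=
  volume.withDensity fun z => ENNReal.ofReal (Real.pi⁻¹ * Real.exp (-‖z‖ ^ (2 : ℝ)))

theorem measurable_complexGaussian_density :
    Measurable fun z : ℂ => ENNReal.ofReal (Real.pi⁻¹ * Real.exp (-‖z‖ ^ (2 : ℝ))) := by
  fun_prop

theorem lintegral_rpow_complexGaussian {p : ℝ} (hp : 0 ≤ p) :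
    ∫⁻ z, ENNReal.ofReal (‖z‖ ^ p) ∂complexGaussian = ENNReal.ofReal (Real.Gamma (1 + p / 2)) := by
  have hG : 0 < Real.Gamma (1 + p / 2) := Real.Gamma_pos_of_pos (by positivity)
  have h := Complex.integral_rpow_mul_exp_neg_rpow (p := 2) (q := p) one_le_two (by linarith)
  have h2 : (p + 2) / 2 = 1 + p / 2 := by ring
  rw [h2, mul_div_assoc, mul_comm 2, div_mul_cancel₀ _ two_ne_zero] at h
  have hi : Integrable fun z : ℂ => ‖z‖ ^ p * Real.exp (-‖z‖ ^ (2 : ℝ)) := by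
    -- A non-integrable function has integral `0` by convention, but the value in `h` is positive.
    by_contra hn
    rw [integral_undef hn] at h
    have := Real.pi_pos
    exact absurd h (by positivity)
  rw [complexGaussian, lintegral_withDensity_eq_lintegral_mul _ measurable_complexGaussian_density
    (by fun_prop)]
  have h3 : ∀ z : ℂ, ((fun z : ℂ => ENNReal.ofReal (Real.pi⁻¹ * Real.exp (-‖z‖ ^ (2 : ℝ)))) *
      fun z : ℂ => ENNReal.ofReal (‖z‖ ^ p)) z =
      ENNReal.ofReal (Real.pi⁻¹ * (‖z‖ ^ p * Real.exp (-‖z‖ ^ (2 : ℝ)))) := fun z => by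
    rw [Pi.mul_apply, ← ENNReal.ofReal_mul (by positivity)]
    congr 1
    ring
  simp_rw [h3]
  rw [← ofReal_integral_eq_lintegral_ofReal (hi.const_mul _)
    (Eventually.of_forall fun z => by positivity), integral_const_mul, h,
    inv_mul_cancel_left₀ Real.pi_ne_zero]

instance instIsProbabilityMeasureComplexGaussian : IsProbabilityMeasure complexGaussian :=
  ⟨by simpa using lintegral_rpow_complexGaussian le_rfl⟩

theorem charFun_complexGaussian (t : ℂ) :
    charFun complexGaussian t = Complex.exp (-(‖t‖ ^ 2 / 4 : ℝ)) := by
  rw [charFun_apply, complexGaussian, integral_withDensity_eq_integral_toReal_smul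
    measurable_complexGaussian_density (by simp)]
  have h := GaussianFourier.integral_cexp_neg_mul_sq_norm_add (V := ℂ) (b := 1) (by simp) Complex.I t
  have h2 : ∀ z : ℂ, (ENNReal.ofReal (Real.pi⁻¹ * Real.exp (-‖z‖ ^ (2 : ℝ)))).toReal •
      Complex.exp (inner ℝ z t * Complex.I) =
      (Real.pi : ℂ)⁻¹ * Complex.exp (-1 * ‖z‖ ^ 2 + Complex.I * inner ℝ t z) := fun z => by
    rw [ENNReal.toReal_ofReal (by positivity), Complex.real_smul, real_inner_comm, Complex.exp_add]
    push_cast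
    rw [Real.rpow_two]
    push_cast
    ring_nf
  simp_rw [h2]
  rw [integral_const_mul, h]
  simp only [Complex.finrank_real_complex, Nat.cast_ofNat, div_one, mul_one]
  rw [div_self two_ne_zero, Complex.cpow_one, inv_mul_cancel_left₀ (by simp), Complex.I_sq]
  push_cast
  ring_nf

/-! ### Central limit theorem for sums of independent points of the circle -/

/-- The normalized sum `(x₁ + ⋯ + x_d) / √d` of the coordinates. -/
def normSum (d : ℕ) (x : Fin d → Circle) : ℂ := ((√d)⁻¹ : ℝ) * ∑ j, (x j : ℂ)

/-- The Haar probability measure of the polytorus `𝕋^d`. -/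
def haarFin (d : ℕ) : Measure (Fin d → Circle) := Measure.infinitePi fun _ => circleMeasure

instance instIsProbabilityMeasureFin (d : ℕ) : IsProbabilityMeasure (haarFin d) :=
  inferInstanceAs (IsProbabilityMeasure (Measure.infinitePi fun _ : Fin d => circleMeasure))

theorem continuous_coe_zpow_circle (m : ℤ) : Continuous fun x : Circle => ((x ^ m : Circle) : ℂ) :=
  (by fun_prop : Continuous fun x : Circle => (x : ℂ)).comp (continuous_zpow m)

theorem continuous_normSum (d : ℕ) : Continuous (normSum d) := by
  unfold normSum
  fun_prop

theorem map_restrict_haarInf {κ : Type*} {g : κ → ℕ} (hg : Function.Injective g) :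
    haarInf.map (fun z i => z (g i)) = Measure.infinitePi fun _ => circleMeasure :=
  Measure.map_infinitePi_infinitePi_of_inj (P := fun _ => circleMeasure) hg

theorem map_coord_haarInf (j : ℕ) : haarInf.map (fun z => z j) = circleMeasure :=
  Measure.infinitePi_map_eval (fun _ : ℕ => circleMeasure) j

theorem integral_circle_zpow {m : ℤ} (hm : m ≠ 0) :
    ∫ x : Circle, ((x ^ m : Circle) : ℂ) ∂circleMeasure = 0 := by
  have h := integral_monomial (Finsupp.single 0 m) (by simpa using hm)
  rw [← map_coord_haarInf 0, integral_map (measurable_pi_apply 0).aemeasurable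
    (continuous_coe_zpow_circle m).aestronglyMeasurable, ← h]
  refine integral_congr_ae (Eventually.of_forall fun z => ?_)
  simp [monomial, Finsupp.support_single _ hm]

theorem integral_inner_circle (t : ℂ) :
    ∫ x : Circle, inner ℝ (x : ℂ) t ∂circleMeasure = 0 := by
  have h := integral_circle_zpow one_ne_zero
  simp only [zpow_one] at h
  have h2 : ∫ x : Circle, inner ℝ t (x : ℂ) ∂circleMeasure =
      inner ℝ t (∫ x : Circle, (x : ℂ) ∂circleMeasure) :=
    integral_inner (Continuous.integrable_of_hasCompactSupport (by fun_prop)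
      (HasCompactSupport.of_compactSpace _)) t
  simp_rw [real_inner_comm t]
  rw [h2, h, inner_zero_right]

theorem integral_inner_circle_sq (t : ℂ) :
    ∫ x : Circle, (inner ℝ (x : ℂ) t) ^ 2 ∂circleMeasure = ‖t‖ ^ 2 / 2 := by
  have h := integral_circle_zpow two_ne_zero
  -- The square of `Re (x t̄)` is a constant plus a character of degree two, which has mean zero.
  have hc : ∀ x : Circle, (inner ℝ (x : ℂ) t) ^ 2 =
      ‖t‖ ^ 2 / 2 + Complex.reCLM ((conj t ^ 2 / 2) * ((x ^ (2 : ℤ) : Circle) : ℂ)) := fun x => by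
    have hx : (x : ℂ).re ^ 2 + (x : ℂ).im ^ 2 = 1 := by
      have := Circle.normSq_coe x
      rw [Complex.normSq_apply] at this
      linarith
    rw [Complex.sq_norm, Complex.normSq_apply, Complex.inner]
    simp [pow_two]
    linear_combination (1 / 2 * (t.re * t.re + t.im * t.im)) * hx
  have hi : Integrable (fun x : Circle => (conj t ^ 2 / 2) * ((x ^ (2 : ℤ) : Circle) : ℂ))
      circleMeasure := Continuous.integrable_of_hasCompactSupport
      (continuous_const.mul (continuous_coe_zpow_circle 2))
      (HasCompactSupport.of_compactSpace _)
  simp_rw [hc]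
  rw [integral_add (by simp) (Complex.reCLM.integrable_comp hi),
    ContinuousLinearMap.integral_comp_comm _ hi, integral_const_mul, h]
  simp

/-- Independence, together with projection onto the direction `t`, reduces the planar limit theorem
to the one on the real line. -/
theorem charFun_map_normSum (d : ℕ) (t : ℂ) :
    charFun ((haarFin d).map (normSum d)) t =
      charFun (circleMeasure.map fun x : Circle => inner ℝ (x : ℂ) t) (√d)⁻¹ ^ d := by
  have hi : iIndepFun (fun (j : Fin d) (x : Fin d → Circle) => (x j : ℂ)) (haarFin d) :=
    iIndepFun_infinitePi (P := fun _ : Fin d => circleMeasure) (X := fun _ x => (x : ℂ))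
      fun _ => by fun_prop
  have h1 : normSum d = fun x => ((√d)⁻¹ : ℝ) • ∑ j, (x j : ℂ) := by
    ext x
    rw [Complex.real_smul, normSum]
  rw [h1, charFun_map_smul_comp (by fun_prop : Continuous fun x : Fin d → Circle =>
    ∑ j, (x j : ℂ)).aemeasurable, hi.charFun_map_fun_sum_eq_prod fun j =>
    (by fun_prop : Continuous fun x : Fin d → Circle => (x j : ℂ)).aemeasurable,
    Finset.prod_apply]
  have h2 : ∀ j : Fin d, charFun ((haarFin d).map fun x => (x j : ℂ)) ((√d)⁻¹ • t) =
      charFun (circleMeasure.map fun x : Circle => inner ℝ (x : ℂ) t) (√d)⁻¹ := fun j => by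
    have h3 : (haarFin d).map (fun x => (x j : ℂ)) = circleMeasure.map (fun x : Circle => (x : ℂ)) := by
      rw [← Measure.infinitePi_map_eval (fun _ : Fin d => circleMeasure) j,
        Measure.map_map (by fun_prop) (by fun_prop)]
      rfl
    rw [h3, charFun_apply, charFun_apply, integral_map (by fun_prop) (by fun_prop),
      integral_map (by fun_prop) (by fun_prop)]
    simp only [inner_smul_right, RCLike.inner_apply, conj_trivial]
  rw [Finset.prod_congr rfl fun j _ => h2 j, Finset.prod_const, Finset.card_univ, Fintype.card_fin]

theorem tendsto_charFun_normSum (t : ℂ) :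
    Tendsto (fun d : ℕ => charFun ((haarFin d).map (normSum d)) t) atTop
      (𝓝 (charFun complexGaussian t)) := by
  rw [charFun_complexGaussian]
  rcases eq_or_ne t 0 with rfl | ht
  · have : ∀ d : ℕ, IsProbabilityMeasure ((haarFin d).map (normSum d)) := fun d =>
      Measure.isProbabilityMeasure_map (continuous_normSum d).aemeasurable
    simp
  have ht' : 0 < ‖t‖ := norm_pos_iff.2 ht
  have hs : √2 ^ 2 = 2 := Real.sq_sqrt zero_le_two
  -- The factor `√2 / ‖t‖` normalizes the variance `‖t‖² / 2` to `1`; evaluation at `‖t‖ / √2`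
  -- undoes it.
  have h := tendsto_charFun_inv_sqrt_mul_pow (P := circleMeasure)
    (X := fun x : Circle => (√2 / ‖t‖) * inner ℝ (x : ℂ) t) (by fun_prop)
    (by rw [integral_const_mul, integral_inner_circle, mul_zero])
    (by
      simp only [Pi.pow_apply, mul_pow]
      rw [integral_const_mul, integral_inner_circle_sq, div_pow, hs]
      field_simp) (‖t‖ / √2)
  have h4 : Complex.exp (-((‖t‖ / √2 : ℝ) : ℂ) ^ 2 / 2) = Complex.exp (-(‖t‖ ^ 2 / 4 : ℝ)) := by
    rw [← Complex.ofReal_pow, div_pow, hs]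
    push_cast
    ring_nf
  rw [h4] at h
  refine h.congr fun d => ?_
  rw [charFun_map_normSum, charFun_map_mul_comp (by fun_prop)]
  congr 2
  field_simp

/-- Weak convergence bounds the measures of open sets from below, hence also integrals of
nonnegative continuous functions. Only this direction is needed, so uniform integrability plays no
role. -/
theorem gamma_le_liminf_lintegral_normSum {p : ℝ} (hp : 0 ≤ p) :
    ENNReal.ofReal (Real.Gamma (1 + p / 2)) ≤
      liminf (fun d : ℕ => ∫⁻ x, ENNReal.ofReal (‖normSum d x‖ ^ p) ∂haarFin d) atTop := by
  have hP : ∀ d : ℕ, IsProbabilityMeasure ((haarFin d).map (normSum d)) := fun d =>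
    Measure.isProbabilityMeasure_map (continuous_normSum d).aemeasurable
  have h := ProbabilityMeasure.tendsto_of_tendsto_charFun
    (μ := fun d => ⟨(haarFin d).map (normSum d), hP d⟩) (μ₀ := ⟨complexGaussian, inferInstance⟩)
    tendsto_charFun_normSum
  rw [← lintegral_rpow_complexGaussian hp]
  refine (lintegral_le_liminf_lintegral_of_forall_isOpen_measure_le_liminf_measure
    (f := fun z : ℂ => ‖z‖ ^ p) (continuous_norm.rpow_const fun _ => Or.inr hp)
    (fun z => by positivity)
    fun G hG => ProbabilityMeasure.le_liminf_measure_open_of_tendsto h hG).trans_eq ?_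
  congr 1
  ext d
  exact lintegral_map (by fun_prop) (continuous_normSum d).measurable

end Polytorus

end
noncomputable section

namespace Polytorus

open ProbabilityTheory

/-! ### Independent blocks of variables -/

/-- The `k`-th block of `d` consecutive coordinates. -/
def block (d k : ℕ) (z : InfTorus) : Fin d → Circle := fun j => z (k * d + j)

@[fun_prop]
theorem measurable_block (d k : ℕ) : Measurable (block d k) :=
  measurable_pi_lambda _ fun _ => measurable_pi_apply _

theorem map_block (d k : ℕ) : haarInf.map (block d k) = haarFin d :=
  map_restrict_haarInf (g := fun j : Fin d => k * d + j) fun i j h => Fin.ext (by simpa using h)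

/-- Division with remainder identifies `ℕ` with `ℕ × Fin d`, and currying turns the product measure
into a product over blocks. -/
theorem iIndepFun_block (d : ℕ) [NeZero d] : iIndepFun (fun k => block d k) haarInf := by
  rw [iIndepFun_iff_map_fun_eq_infinitePi_map (measurable_block d)]
  simp only [map_block]
  have h := map_restrict_haarInf (Nat.divModEquiv d).symm.injective
  have h2 := Measure.infinitePi_map_curry (fun (_ : ℕ) (_ : Fin d) => circleMeasure)
  rw [← h, Measure.map_map (by fun_prop) (by fun_prop)] at h2
  exact h2

/-- The product of the functions `f` of the first `n` blocks of `d` coordinates. -/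
def blockProd (n d : ℕ) (f : (Fin d → Circle) → ℂ) (z : InfTorus) : ℂ :=
  ∏ k : Fin n, f (block d k z)

theorem measurable_blockProd {n d : ℕ} {f : (Fin d → Circle) → ℂ} (hf : Measurable f) :
    Measurable (blockProd n d f) := by
  unfold blockProd
  fun_prop

theorem iIndepFun_block_fin (n d : ℕ) [NeZero d] :
    iIndepFun (fun k : Fin n => block d k) haarInf :=
  (iIndepFun_block d).precomp Fin.val_injective

theorem eLpNorm_blockProd (n : ℕ) {d : ℕ} [NeZero d] {f : (Fin d → Circle) → ℂ}
    (hf : Measurable f) {p : ℝ≥0∞} (h0 : p ≠ 0) (ht : p ≠ ∞) :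
    eLpNorm (blockProd n d f) p haarInf = eLpNorm f p (haarFin d) ^ n := by
  have hp := ENNReal.toReal_nonneg (a := p)
  rw [eLpNorm_eq_lintegral_rpow_enorm_toReal h0 ht, eLpNorm_eq_lintegral_rpow_enorm_toReal h0 ht]
  have h1 : ∀ z, ‖blockProd n d f z‖ₑ ^ p.toReal =
      ∏ k : Fin n, ‖f (block d k z)‖ₑ ^ p.toReal := fun z => by
    have : ‖blockProd n d f z‖ₑ = ∏ k : Fin n, ‖f (block d k z)‖ₑ := by
      simp only [blockProd, enorm_eq_nnnorm, nnnorm_prod]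
      push_cast
      rfl
    rw [this, ENNReal.prod_rpow_of_nonneg hp]
  simp_rw [h1]
  rw [lintegral_prod_eq_prod_lintegral_of_indepFun Finset.univ
    (fun (k : Fin n) z => ‖f (block d k z)‖ₑ ^ p.toReal)
    ((iIndepFun_block_fin n d).comp (fun _ x => ‖f x‖ₑ ^ p.toReal) (by fun_prop)) (by fun_prop)]
  have h2 : ∀ k : Fin n, ∫⁻ z, ‖f (block d k z)‖ₑ ^ p.toReal ∂haarInf =
      ∫⁻ x, ‖f x‖ₑ ^ p.toReal ∂haarFin d := fun k => by
    rw [← map_block d k, lintegral_map (by fun_prop) (by fun_prop)]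
  simp_rw [h2]
  rw [Finset.prod_const, Finset.card_univ, Fintype.card_fin, ← ENNReal.rpow_natCast,
    ← ENNReal.rpow_natCast, ← ENNReal.rpow_mul, ← ENNReal.rpow_mul, mul_comm]

/-! ### Rotations and the vanishing of Fourier coefficients -/

theorem monomial_add (α β : ℕ →₀ ℤ) (z : InfTorus) :
    monomial (α + β) z = monomial α z * monomial β z := by
  have h : ∀ γ : ℕ →₀ ℤ, monomial γ z = ((γ.prod fun j k => z j ^ k : Circle) : ℂ) :=
    fun γ => rfl
  rw [h, h, h, Finsupp.prod_add_index' (by simp) (by simp [zpow_add]), Circle.coe_mul]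

theorem monomial_zero (z : InfTorus) : monomial 0 z = 1 := by
  simp [monomial]

theorem monomial_sum {ι : Type*} (s : Finset ι) (α : ι → ℕ →₀ ℤ) (z : InfTorus) :
    monomial (∑ i ∈ s, α i) z = ∏ i ∈ s, monomial (α i) z := by
  classical
  induction s using Finset.induction_on with
  | empty => simp [monomial_zero]
  | insert a s ha ih => rw [Finset.sum_insert ha, Finset.prod_insert ha, monomial_add, ih]

theorem monomial_single_one (i : ℕ) (z : InfTorus) : monomial (Finsupp.single i 1) z = z i := by
  simp [monomial, Finsupp.support_single]

theorem norm_monomial (α : ℕ →₀ ℤ) (z : InfTorus) : ‖monomial α z‖ = 1 :=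
  Circle.norm_coe _

/-- By invariance of Haar measure, substituting `w * z` multiplies the coefficient by `c * conj
(w^α)`, which differs from `1`. -/
theorem fourierCoeff_eq_zero_of_rotation {F : InfTorus → ℂ} (hF : Measurable F) {w : InfTorus}
    {c : ℂ} (hw : ∀ z, F (w * z) = c * F z) {α : ℕ →₀ ℤ} (hc : c ≠ monomial α w) :
    fourierCoeff F α = 0 := by
  have h : fourierCoeff F α = c * conj (monomial α w) * fourierCoeff F α := by
    conv_lhs => rw [fourierCoeff, ← map_mul_haarInf w]
    have hm : Measurable fun z => F z * conj (monomial α z) :=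
      hF.mul (Complex.continuous_conj.comp (monomial α).continuous).measurable
    rw [integral_map (by fun_prop) hm.aestronglyMeasurable, fourierCoeff, ← integral_const_mul]
    refine integral_congr_ae (Filter.Eventually.of_forall fun z => ?_)
    simp only [hw, monomial_mul, map_mul]
    ring
  by_contra h0
  refine hc ?_
  have h1 : c * conj (monomial α w) = 1 := by
    refine mul_right_cancel₀ h0 ?_
    rw [← h, one_mul]
  have h2 : monomial α w * conj (monomial α w) = 1 := by
    rw [Complex.mul_conj, Complex.normSq_eq_norm_sq, norm_monomial]
    simp
  linear_combination monomial α w * h1 - c * h2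

/-- The point all of whose coordinates are `1` except those in the `k`-th block, which are `θ`. -/
def rotateBlock (d k : ℕ) (θ : Circle) : InfTorus := fun i => if i / d = k then θ else 1

theorem monomial_rotateBlock (d k : ℕ) (θ : Circle) (α : ℕ →₀ ℤ) :
    monomial α (rotateBlock d k θ) =
      ((θ ^ ∑ i ∈ α.support with i / d = k, α i : Circle) : ℂ) := by
  have h : ∏ i ∈ α.support, rotateBlock d k θ i ^ α i =
      θ ^ ∑ i ∈ α.support with i / d = k, α i := by
    rw [Finset.sum_filter]
    induction α.support using Finset.induction_on with
    | empty => simp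
    | insert a s ha ih =>
      rw [Finset.prod_insert ha, Finset.sum_insert ha, ih, zpow_add, rotateBlock]
      split_ifs <;> simp
  exact congrArg Circle.coeHom h

theorem block_rotateBlock_mul (d k l : ℕ) [NeZero d] (θ : Circle) (z : InfTorus) :
    block d l (rotateBlock d k θ * z) = fun j => (if l = k then θ else 1) * block d l z j := by
  ext j : 1
  have : (l * d + j) / d = l := by
    rw [add_comm, Nat.add_mul_div_right _ _ (NeZero.pos d), Nat.div_eq_of_lt j.2, zero_add]
  simp [block, rotateBlock, this]

theorem blockProd_rotateBlock_mul (n d k : ℕ) [NeZero d] {f : (Fin d → Circle) → ℂ}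
    (hf : ∀ (θ : Circle) x, f (fun j => θ * x j) = θ * f x) (θ : Circle) (z : InfTorus) :
    blockProd n d f (rotateBlock d k θ * z) =
      ((θ ^ (if k < n then 1 else 0 : ℤ) : Circle) : ℂ) * blockProd n d f z := by
  simp only [blockProd, block_rotateBlock_mul, hf, Finset.prod_mul_distrib]
  congr 1
  split_ifs with hk
  · rw [Finset.prod_eq_single ⟨k, hk⟩]
    · simp
    · intro l _ hl
      rw [if_neg fun h => hl (Fin.ext h), Circle.coe_one]
    · simp
  · rw [Finset.prod_eq_one]
    · simp
    · intro l _
      rw [if_neg (by have := l.2; omega), Circle.coe_one]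

theorem exists_zpow_ne {a b : ℤ} (h : a ≠ b) : ∃ θ : Circle, θ ^ a ≠ θ ^ b := by
  -- This `θ` satisfies `θ ^ (a - b) = -1`.
  refine ⟨Circle.exp (Real.pi / (a - b : ℤ)), fun he => ?_⟩
  have hne : ((a : ℂ) - b) ≠ 0 := by exact_mod_cast sub_ne_zero.2 h
  have h1 : Circle.exp (Real.pi / (a - b : ℤ)) ^ (a - b) = 1 := by
    rw [zpow_sub, he, mul_inv_cancel]
  have h2 := congrArg (fun x : Circle => (x : ℂ)) h1
  simp only [Circle.coe_zpow, Circle.coe_exp, ← Complex.exp_int_mul, Circle.coe_one] at h2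
  have h3 : ((a - b : ℤ) : ℂ) * (((Real.pi / (a - b : ℤ) : ℝ) : ℂ) * Complex.I) =
      Real.pi * Complex.I := by
    push_cast
    field_simp
  rw [h3, Complex.exp_pi_mul_I] at h2
  norm_num at h2

/-- Rotating the `k`-th block alone shows that a surviving frequency has there the degree of the
product: one for `k < n`, zero afterwards. -/
theorem sum_block_eq_of_fourierCoeff_ne_zero {n d : ℕ} [NeZero d] {f : (Fin d → Circle) → ℂ}
    (hm : Measurable f) (hf : ∀ (θ : Circle) x, f (fun j => θ * x j) = θ * f x) {α : ℕ →₀ ℤ}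
    (hα : fourierCoeff (blockProd n d f) α ≠ 0) (k : ℕ) :
    ∑ i ∈ α.support with i / d = k, α i = if k < n then 1 else 0 := by
  by_contra hne
  obtain ⟨θ, hθ⟩ := exists_zpow_ne hne
  refine hα (fourierCoeff_eq_zero_of_rotation (measurable_blockProd hm)
    (blockProd_rotateBlock_mul n d k hf θ) ?_)
  rw [monomial_rotateBlock]
  exact fun h => hθ (Circle.coe_injective h.symm)

/-! ### Frequencies surviving the projection -/

/-- The multi-index with an entry `1` at the position `φ k` of the `k`-th block, for `k < n`. -/
def blockIndex {n d : ℕ} (φ : Fin n → Fin d) : ℕ →₀ ℤ :=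
  ∑ k : Fin n, Finsupp.single (k * d + φ k) 1

theorem monomial_blockIndex {n d : ℕ} (φ : Fin n → Fin d) (z : InfTorus) :
    monomial (blockIndex φ) z = ∏ k : Fin n, (block d k z (φ k) : ℂ) := by
  simp only [blockIndex, monomial_sum, monomial_single_one, block]

theorem blockIndex_apply {n d : ℕ} (φ : Fin n → Fin d) (i : ℕ) :
    blockIndex φ i = ∑ k : Fin n, if k * d + φ k = i then 1 else 0 := by
  simp [blockIndex, Finsupp.finsetSum_apply, Finsupp.single_apply]

theorem blockIndex_nonneg {n d : ℕ} (φ : Fin n → Fin d) : blockIndex φ ∈ nonnegIndices := by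
  intro i
  rw [blockIndex_apply]
  exact Finset.sum_nonneg fun k _ => by split_ifs <;> simp

theorem mul_add_fin_eq_iff {d : ℕ} (k : ℕ) (j : Fin d) (i : ℕ) :
    k * d + j = i ↔ i / d = k ∧ i % d = j := by
  have hd := j.pos
  constructor
  · rintro rfl
    constructor
    · rw [add_comm, Nat.add_mul_div_right _ _ hd, Nat.div_eq_of_lt j.2, zero_add]
    · rw [add_comm, Nat.add_mul_mod_self_right, Nat.mod_eq_of_lt j.2]
  · rintro ⟨rfl, h⟩
    rw [← h, Nat.div_add_mod']

theorem blockIndex_injective (n d : ℕ) :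
    Function.Injective (blockIndex : (Fin n → Fin d) → ℕ →₀ ℤ) := by
  intro φ ψ h
  ext k
  have h1 : ∀ χ : Fin n → Fin d, blockIndex χ (k * d + φ k) = if χ k = φ k then 1 else 0 := by
    intro χ
    rw [blockIndex_apply, Finset.sum_eq_single k]
    · simp [Fin.ext_iff]
    · intro l _ hl
      refine if_neg fun he => hl ?_
      have h2 := ((mul_add_fin_eq_iff _ _ _).1 he).1
      have h3 := ((mul_add_fin_eq_iff (k : ℕ) (φ k) _).1 rfl).1
      exact Fin.ext (h2.symm.trans h3)
    · simp
  have h2 := h1 ψ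
  rw [← h, h1 φ, if_pos rfl] at h2
  by_contra hne
  rw [if_neg fun h => hne (congrArg Fin.val h.symm)] at h2
  exact one_ne_zero h2

theorem exists_eq_one_of_sum_eq_one {s : Finset ℕ} {α : ℕ → ℤ} (hα : ∀ i, 0 ≤ α i)
    (hs : ∑ i ∈ s, α i = 1) : ∃ j ∈ s, α j = 1 ∧ ∀ i ∈ s, i ≠ j → α i = 0 := by
  obtain ⟨j, hj, hj0⟩ := Finset.exists_ne_zero_of_sum_ne_zero (hs.trans_ne one_ne_zero)
  rw [← Finset.add_sum_erase _ _ hj] at hs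
  have h1 := Finset.sum_nonneg fun i (_ : i ∈ s.erase j) => hα i
  have h2 := hα j
  refine ⟨j, hj, by omega, fun i hi hij => ?_⟩
  exact (Finset.sum_eq_zero_iff_of_nonneg fun i _ => hα i).1 (by omega) i
    (Finset.mem_erase.2 ⟨hij, hi⟩)

/-- Nonnegativity is decisive: nonnegative integers with sum `1` are a single `1` and zeros, and
those with sum `0` all vanish. Here `J k` is the position of the `1` in block `k`. -/
theorem exists_blockIndex_eq {n d : ℕ} [NeZero d] {α : ℕ →₀ ℤ} (hα : α ∈ nonnegIndices)
    (h : ∀ k, ∑ i ∈ α.support with i / d = k, α i = if k < n then 1 else 0) :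
    ∃ φ : Fin n → Fin d, blockIndex φ = α := by
  have hn : ∀ k : Fin n, ∃ j, j / d = k ∧ α j = 1 ∧ ∀ i, i / d = k → i ≠ j → α i = 0 := by
    intro k
    obtain ⟨j, hj, hj1, hj2⟩ := exists_eq_one_of_sum_eq_one hα ((h k).trans (if_pos k.2))
    refine ⟨j, (Finset.mem_filter.1 hj).2, hj1, fun i hi hij => ?_⟩
    by_contra h0
    exact h0 (hj2 i (Finset.mem_filter.2 ⟨Finsupp.mem_support_iff.2 h0, hi⟩) hij)
  choose J hJ1 hJ2 hJ3 using hn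
  refine ⟨fun k => ⟨J k % d, Nat.mod_lt _ (NeZero.pos d)⟩, ?_⟩
  ext i
  have h1 : ∀ k : Fin n, (k : ℕ) * d + J k % d = J k := fun k => by
    rw [← hJ1 k, Nat.div_add_mod']
  simp only [blockIndex_apply, h1]
  by_cases hi : i / d < n
  · rw [Finset.sum_eq_single ⟨i / d, hi⟩]
    · split_ifs with he
      · rw [← hJ2 ⟨i / d, hi⟩, he]
      · exact (hJ3 ⟨i / d, hi⟩ i rfl (Ne.symm he)).symm
    · intro l _ hl
      refine if_neg fun he => hl (Fin.ext ?_)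
      rw [← hJ1 l, he]
    · simp
  · rw [Finset.sum_eq_zero]
    · by_contra h0
      have h2 := h (i / d)
      rw [if_neg hi, Finset.sum_eq_zero_iff_of_nonneg fun i _ => hα i] at h2
      exact h0 (h2 i (Finset.mem_filter.2 ⟨Finsupp.mem_support_iff.2 (Ne.symm h0), rfl⟩)).symm
    · intro k _
      refine if_neg fun he => hi ?_
      rw [← he, hJ1 k]
      exact k.2

theorem fourierCoeff_blockProd_blockIndex {n d : ℕ} [NeZero d] {f : (Fin d → Circle) → ℂ}
    (hm : Measurable f) {a : ℂ} (ha : ∀ j, ∫ x, f x * conj (x j : ℂ) ∂haarFin d = a)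
    (φ : Fin n → Fin d) : fourierCoeff (blockProd n d f) (blockIndex φ) = a ^ n := by
  have hmj : ∀ j, Measurable fun x : Fin d → Circle => f x * conj (x j : ℂ) := fun j =>
    hm.mul (by fun_prop : Continuous fun x : Fin d → Circle => conj (x j : ℂ)).measurable
  have h1 : ∀ z, blockProd n d f z * conj (monomial (blockIndex φ) z) =
      ∏ k : Fin n, (fun x => f x * conj (x (φ k) : ℂ)) (block d k z) := fun z => by
    rw [monomial_blockIndex, map_prod, blockProd, ← Finset.prod_mul_distrib]
  rw [fourierCoeff]
  simp_rw [h1]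
  rw [(iIndepFun_block_fin n d).integral_fun_prod_comp
    (f := fun k x => f x * conj (x (φ k) : ℂ)) (by fun_prop)
    fun k => (hmj (φ k)).aestronglyMeasurable]
  have h2 : ∀ k : Fin n, ∫ z, f (block d k z) * conj (block d k z (φ k) : ℂ) ∂haarInf = a :=
    fun k => by
      rw [← ha (φ k), ← map_block d k, integral_map (by fun_prop) (hmj _).aestronglyMeasurable]
  simp_rw [h2]
  simp

/-- If `f` is homogeneous of degree one under rotations of `𝕋^d` and all its Fourier coefficients
of degree one agree, then the Riesz projection of a product of `n` copies of `f` in independent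
variables is the product of `n` copies of the linear part of `f`. -/
theorem rieszProjection_blockProd {n d : ℕ} [NeZero d] {f : (Fin d → Circle) → ℂ}
    (hm : Measurable f) (hf : ∀ (θ : Circle) x, f (fun j => θ * x j) = θ * f x)
    {a : ℂ} (ha : ∀ j, ∫ x, f x * conj (x j : ℂ) ∂haarFin d = a) :
    rieszProjection (blockProd n d f) =ᵐ[haarInf] blockProd n d fun x => a * ∑ j, (x j : ℂ) := by
  have h1 : rieszProjection (blockProd n d f) =
      ∑ φ : Fin n → Fin d, a ^ n • monomialL2 (blockIndex φ) := by
    let g : (Fin n → Fin d) → nonnegIndices := fun φ => ⟨blockIndex φ, blockIndex_nonneg φ⟩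
    have hg : Function.Injective g := fun φ ψ h =>
      blockIndex_injective n d (congrArg Subtype.val h)
    -- All nonzero terms lie in the range of `g`, so the series is a finite sum over choices of one
    -- variable per block.
    rw [rieszProjection, ← hg.tsum_eq, tsum_fintype]
    · exact Finset.sum_congr rfl fun φ _ => by rw [fourierCoeff_blockProd_blockIndex hm ha]
    · intro α hα
      have h0 : fourierCoeff (blockProd n d f) α ≠ 0 := fun h0 => hα (by simp [h0])
      obtain ⟨φ, hφ⟩ := exists_blockIndex_eq α.2 (sum_block_eq_of_fourierCoeff_ne_zero hm hf h0)
      exact ⟨φ, Subtype.ext hφ⟩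
  have h2 : rieszProjection (blockProd n d f) =
      ContinuousMap.toLp 2 haarInf ℂ (∑ φ : Fin n → Fin d, a ^ n • monomial (blockIndex φ)) := by
    rw [h1, map_sum]
    simp only [map_smul, monomialL2]
  rw [h2]
  refine (ContinuousMap.coeFn_toLp (p := 2) (𝕜 := ℂ) haarInf _).trans
    (Filter.Eventually.of_forall fun z => ?_)
  -- Expanding the product over blocks of sums over coordinates gives the sum over all `φ`.
  simp only [ContinuousMap.coe_sum, ContinuousMap.coe_smul, Finset.sum_apply, Pi.smul_apply,
    smul_eq_mul, monomial_blockIndex, blockProd, Finset.prod_mul_distrib, Finset.prod_const,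
    Finset.card_univ, Fintype.card_fin, Finset.prod_univ_sum, Fintype.piFinset_univ,
    Finset.mul_sum]

end Polytorus

end
noncomputable section

namespace Polytorus

open Filter
open scoped Topology

/-! ### The extremal function and its norms -/

/-- The function `|S|^(r-2) S`, where `S` is the normalized sum of the coordinates. -/
def powSum (d : ℕ) (r : ℝ) (x : Fin d → Circle) : ℂ :=
  ((‖normSum d x‖ ^ (r - 2) : ℝ) : ℂ) * normSum d x

theorem normSum_rotate (d : ℕ) (θ : Circle) (x : Fin d → Circle) :
    normSum d (fun j => θ * x j) = θ * normSum d x := by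
  simp only [normSum, Circle.coe_mul, ← Finset.mul_sum]
  ring

theorem normSum_comp_perm {d : ℕ} (σ : Equiv.Perm (Fin d)) (x : Fin d → Circle) :
    normSum d (fun j => x (σ j)) = normSum d x := by
  simp only [normSum, Equiv.sum_comp σ fun j => (x j : ℂ)]

theorem measurable_normSum (d : ℕ) : Measurable (normSum d) :=
  (continuous_normSum d).measurable

theorem measurable_powSum (d : ℕ) (r : ℝ) : Measurable (powSum d r) := by
  have := measurable_normSum d
  unfold powSum
  fun_prop

theorem powSum_rotate (d : ℕ) (r : ℝ) (θ : Circle) (x : Fin d → Circle) :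
    powSum d r (fun j => θ * x j) = θ * powSum d r x := by
  simp only [powSum, normSum_rotate, norm_mul, Circle.norm_coe, one_mul]
  ring

/-- Equality can fail at a zero of `S`: for `r = 1` the right side is `0 ^ 0 = 1` there. -/
theorem norm_powSum_le (d : ℕ) (r : ℝ) (x : Fin d → Circle) :
    ‖powSum d r x‖ ≤ ‖normSum d x‖ ^ (r - 1) := by
  rw [powSum, norm_mul, Complex.norm_of_nonneg (by positivity)]
  rcases (norm_nonneg (normSum d x)).eq_or_lt with h | h
  · rw [← h, mul_zero]
    positivity
  · rw [← Real.rpow_add_one h.ne']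
    exact (congrArg _ (by ring)).le

theorem powSum_mul_conj_normSum (d : ℕ) {r : ℝ} (hr : r ≠ 0) (x : Fin d → Circle) :
    powSum d r x * conj (normSum d x) = ((‖normSum d x‖ ^ r : ℝ) : ℂ) := by
  rw [powSum, mul_assoc, Complex.mul_conj, Complex.normSq_eq_norm_sq]
  rcases (norm_nonneg (normSum d x)).eq_or_lt with h | h
  · rw [← h, Real.zero_rpow hr]
    simp
  · rw [← Complex.ofReal_mul, ← Real.rpow_two, ← Real.rpow_add h, sub_add_cancel]

theorem exists_norm_powSum_le (d : ℕ) {r : ℝ} (hr : 1 ≤ r) :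
    ∃ M : ℝ, ∀ x, ‖powSum d r x‖ ≤ M := by
  obtain ⟨M, hM⟩ := (isCompact_univ (X := Fin d → Circle)).exists_bound_of_continuousOn
    ((continuous_normSum d).norm.rpow_const fun _ => Or.inr (sub_nonneg.2 hr)).continuousOn
  exact ⟨M, fun x => (norm_powSum_le d r x).trans ((le_abs_self _).trans (hM x trivial))⟩

theorem integrable_of_continuous_fin {d : ℕ} {E : Type*} [NormedAddCommGroup E]
    {g : (Fin d → Circle) → E} (hg : Continuous g) : Integrable g (haarFin d) :=
  hg.integrable_of_hasCompactSupport (HasCompactSupport.of_compactSpace _)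

theorem integrable_powSum_mul_conj (d : ℕ) {r : ℝ} (hr : 1 ≤ r) (j : Fin d) :
    Integrable (fun x => powSum d r x * conj (x j : ℂ)) (haarFin d) := by
  obtain ⟨M, hM⟩ := exists_norm_powSum_le d hr
  exact (integrable_of_continuous_fin (by fun_prop)).bdd_mul
    (measurable_powSum d r).aestronglyMeasurable (Eventually.of_forall hM)

/-- Swapping coordinates shows that all `d` coefficients equal one `c`. Pairing `|S|^(r-2) S` with
`S` gives `E|S|^r = √d · c`. -/
theorem integral_powSum_mul_conj (d : ℕ) {r : ℝ} (hr : 1 ≤ r) (j : Fin d) :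
    ∫ x, powSum d r x * conj (x j : ℂ) ∂haarFin d =
      ((∫ x, ‖normSum d x‖ ^ r ∂haarFin d : ℝ) : ℂ) * ((√d)⁻¹ : ℝ) := by
  have hd : (0 : ℝ) < d := Nat.cast_pos.2 j.pos
  have hsym : ∀ i, ∫ x, powSum d r x * conj (x i : ℂ) ∂haarFin d =
      ∫ x, powSum d r x * conj (x j : ℂ) ∂haarFin d := fun i => by
    have hσ : (haarFin d).map (fun x k => x (Equiv.swap i j k)) = haarFin d :=
      Measure.map_infinitePi_infinitePi_of_inj (P := fun _ : Fin d => circleMeasure)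
        (Equiv.swap i j).injective
    conv_lhs => rw [← hσ]
    have hm : Measurable fun x : Fin d → Circle => powSum d r x * conj (x i : ℂ) :=
      (measurable_powSum d r).mul
        (by fun_prop : Continuous fun x : Fin d → Circle => conj (x i : ℂ)).measurable
    rw [integral_map (measurable_pi_lambda _ fun _ => measurable_pi_apply _).aemeasurable
      hm.aestronglyMeasurable]
    simp only [powSum, normSum_comp_perm, Equiv.swap_apply_left]
  have h1 : ((∫ x, ‖normSum d x‖ ^ r ∂haarFin d : ℝ) : ℂ) =
      ((√d)⁻¹ : ℝ) * (d * ∫ x, powSum d r x * conj (x j : ℂ) ∂haarFin d) := by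
    rw [← integral_complex_ofReal]
    have h2 : ∀ x, ((‖normSum d x‖ ^ r : ℝ) : ℂ) =
        ((√d)⁻¹ : ℝ) * ∑ i, powSum d r x * conj (x i : ℂ) := fun x => by
      rw [← powSum_mul_conj_normSum d (by linarith) x]
      conv_lhs => rw [normSum]
      rw [map_mul, Complex.conj_ofReal, map_sum, ← Finset.mul_sum]
      ring
    simp_rw [h2]
    rw [integral_const_mul, integral_finsetSum _ fun i _ => integrable_powSum_mul_conj d hr i,
      Finset.sum_congr rfl fun i _ => hsym i]
    simp
  have h3 : (((√d)⁻¹ : ℝ) : ℂ) * ((√d)⁻¹ : ℝ) * d = 1 := by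
    rw [← Complex.ofReal_mul, ← mul_inv, Real.mul_self_sqrt hd.le]
    push_cast
    exact inv_mul_cancel₀ (by exact_mod_cast hd.ne')
  rw [h1]
  linear_combination (-∫ x, powSum d r x * conj (x j : ℂ) ∂haarFin d) * h3

theorem rieszProjection_blockProd_powSum (n : ℕ) {d : ℕ} [NeZero d] {r : ℝ} (hr : 1 ≤ r) :
    rieszProjection (blockProd n d (powSum d r)) =ᵐ[haarInf]
      blockProd n d fun x => ((∫ x, ‖normSum d x‖ ^ r ∂haarFin d : ℝ) : ℂ) * normSum d x := by
  refine (rieszProjection_blockProd (measurable_powSum d r) (powSum_rotate d r)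
    (integral_powSum_mul_conj d hr)).trans (Eventually.of_forall fun z => ?_)
  simp only [normSum, mul_assoc]

theorem ofReal_integral_norm_normSum (d : ℕ) {r : ℝ} (hr : 0 ≤ r) :
    ENNReal.ofReal (∫ x, ‖normSum d x‖ ^ r ∂haarFin d) =
      ∫⁻ x, ENNReal.ofReal (‖normSum d x‖ ^ r) ∂haarFin d :=
  ofReal_integral_eq_lintegral_ofReal (integrable_of_continuous_fin
    ((continuous_normSum d).norm.rpow_const fun _ => Or.inr hr))
    (Eventually.of_forall fun _ => by positivity)

theorem eLpNorm_normSum {d : ℕ} {p : ℝ≥0∞} (h0 : p ≠ 0) (ht : p ≠ ∞) :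
    eLpNorm (normSum d) p (haarFin d) =
      (∫⁻ x, ENNReal.ofReal (‖normSum d x‖ ^ p.toReal) ∂haarFin d) ^ (1 / p.toReal) := by
  rw [eLpNorm_eq_lintegral_rpow_enorm_toReal h0 ht]
  simp_rw [← ofReal_norm, ENNReal.ofReal_rpow_of_nonneg (norm_nonneg _) ENNReal.toReal_nonneg]

theorem eLpNorm_rieszProjection_blockProd_powSum (n : ℕ) {d : ℕ} [NeZero d] {r : ℝ} (hr : 1 ≤ r)
    {p : ℝ≥0∞} (h0 : p ≠ 0) (ht : p ≠ ∞) :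
    eLpNorm (rieszProjection (blockProd n d (powSum d r))) p haarInf =
      ((∫⁻ x, ENNReal.ofReal (‖normSum d x‖ ^ r) ∂haarFin d) *
        eLpNorm (normSum d) p (haarFin d)) ^ n := by
  rw [eLpNorm_congr_ae (rieszProjection_blockProd_powSum n hr),
    eLpNorm_blockProd n ((measurable_normSum d).const_mul _) h0 ht]
  congr 1
  rw [← ofReal_integral_norm_normSum d (zero_le_one.trans hr)]
  have hm : 0 ≤ ∫ x, ‖normSum d x‖ ^ r ∂haarFin d := integral_nonneg fun _ => by positivity
  have h := eLpNorm_const_smul ((∫ x, ‖normSum d x‖ ^ r ∂haarFin d : ℝ) : ℂ) (normSum d) p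
    (haarFin d)
  rw [← ofReal_norm, Complex.norm_of_nonneg hm] at h
  exact h

/-- For Hölder conjugate exponents `q` and `r` the norm of `|S|^(r-2) S` in `L^q` is at most
`‖S‖_r ^ (r-1)`. -/
theorem eLpNorm_blockProd_powSum_le (n : ℕ) {d : ℕ} [NeZero d] {q : ℝ≥0∞} {r : ℝ} (hr : 1 ≤ r)
    (hq : q ≠ 0) (hqr : 1 / q.toReal = 1 - 1 / r) :
    eLpNorm (blockProd n d (powSum d r)) q haarInf ≤
      ((∫⁻ x, ENNReal.ofReal (‖normSum d x‖ ^ r) ∂haarFin d) ^ (1 - 1 / r)) ^ n := by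
  have hr0 : 0 < r := by linarith
  rw [← hqr]
  rcases eq_or_ne q ∞ with rfl | ht
  -- Since `∞.toReal = 0` and `1 / 0 = 0`, the relation `hqr` reads `0 = 1 - 1 / r`; the test
  -- function is then bounded by `1`.
  · have hr1 : r = 1 := by
      simp only [ENNReal.toReal_top, div_zero] at hqr
      field_simp at hqr
      linarith
    simp only [ENNReal.toReal_top, div_zero, ENNReal.rpow_zero, one_pow]
    refine eLpNormEssSup_le_of_ae_bound (C := 1) (Eventually.of_forall fun z => ?_) |>.trans
      (by simp)
    rw [blockProd, norm_prod]
    refine Finset.prod_le_one (fun _ _ => norm_nonneg _) fun k _ => ?_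
    refine (norm_powSum_le d r _).trans ?_
    rw [hr1, sub_self, Real.rpow_zero]
  · have hq0 : 0 < q.toReal := ENNReal.toReal_pos hq ht
    have hexp : (r - 1) * q.toReal = r := by
      field_simp at hqr
      linarith
    rw [eLpNorm_blockProd n (measurable_powSum d r) hq ht,
      eLpNorm_eq_lintegral_rpow_enorm_toReal hq ht]
    gcongr with x
    rw [← ofReal_norm, ENNReal.ofReal_rpow_of_nonneg (norm_nonneg _) hq0.le]
    refine ENNReal.ofReal_le_ofReal ?_
    calc ‖powSum d r x‖ ^ q.toReal ≤ (‖normSum d x‖ ^ (r - 1)) ^ q.toReal := by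
          gcongr
          exact norm_powSum_le d r x
      _ = ‖normSum d x‖ ^ r := by rw [← Real.rpow_mul (norm_nonneg _), hexp]

theorem memLp_blockProd_powSum (n : ℕ) {d : ℕ} {r : ℝ} (hr : 1 ≤ r) (q : ℝ≥0∞) :
    MemLp (blockProd n d (powSum d r)) q haarInf := by
  obtain ⟨M, hM⟩ := exists_norm_powSum_le d hr
  refine MemLp.of_bound (measurable_blockProd (measurable_powSum d r)).aestronglyMeasurable
    (M ^ n) (Eventually.of_forall fun z => ?_)
  rw [blockProd, norm_prod]
  refine (Finset.prod_le_prod (fun _ _ => norm_nonneg _) fun k _ => hM _).trans_eq ?_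
  simp

/-- If the product of the norms of the normalized sum in `L^p` and `L^r` exceeds `1`, then products
of independent copies of `|S|^(r-2) S` show that the Riesz projection is unbounded. -/
theorem not_rieszBounded_of_one_lt {d : ℕ} [NeZero d] {p q : ℝ≥0∞} {r : ℝ} (hr : 1 ≤ r)
    (hq : q ≠ 0) (hqr : 1 / q.toReal = 1 - 1 / r) (h0 : p ≠ 0) (ht : p ≠ ∞)
    (h : 1 < eLpNorm (normSum d) p (haarFin d) *
      (∫⁻ x, ENNReal.ofReal (‖normSum d x‖ ^ r) ∂haarFin d) ^ (1 / r)) :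
    ¬ RieszBounded q p := by
  rintro ⟨C, hC⟩
  have hr0 : 0 < r := by linarith
  set m := ∫⁻ x, ENNReal.ofReal (‖normSum d x‖ ^ r) ∂haarFin d with hm
  set A := eLpNorm (normSum d) p (haarFin d)
  have hmt : m ≠ ∞ := by
    rw [hm, ← ofReal_integral_norm_normSum d hr0.le]
    exact ENNReal.ofReal_ne_top
  have hm0 : m ≠ 0 := by
    intro hm0
    rw [hm0, ENNReal.zero_rpow_of_pos (by positivity), mul_zero] at h
    exact not_lt_zero h
  -- The last factor bounds the `L^q` norm of the test function and cancels, leaving the gain `‖S‖_p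
  -- ‖S‖_r` per block.
  have hmA : m * A = (A * m ^ (1 / r)) * m ^ (1 - 1 / r) := by
    rw [mul_assoc, ← ENNReal.rpow_add _ _ hm0 hmt, add_sub_cancel, ENNReal.rpow_one, mul_comm]
  have hle : ∀ n : ℕ, (A * m ^ (1 / r)) ^ n ≤ C := fun n => by
    have h1 := (hC _ (memLp_blockProd_powSum n hr q)).trans
      (mul_le_mul_right (eLpNorm_blockProd_powSum_le (d := d) n hr hq hqr) (C : ℝ≥0∞))
    rw [eLpNorm_rieszProjection_blockProd_powSum n hr h0 ht, ← hm, hmA, mul_pow] at h1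
    refine (ENNReal.mul_le_mul_iff_left ?_ ?_).1 h1
    · exact pow_ne_zero _ (ENNReal.rpow_pos (pos_iff_ne_zero.2 hm0) hmt).ne'
    · exact ENNReal.pow_ne_top (ENNReal.rpow_ne_top_of_ne_zero hm0 hmt)
  have h2 : (⊤ : ℝ≥0∞) ≤ C := le_of_tendsto'
    (ENNReal.tendsto_pow_atTop_nhds_top_iff.2 h) hle
  exact ENNReal.coe_ne_top (top_le_iff.1 h2)

/-! ### The Gamma condition and the conclusion -/

theorem gammaRoot_of_ne_top {p : ℝ≥0∞} (ht : p ≠ ∞) :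
    gammaRoot p = ENNReal.ofReal (Real.Gamma (1 + p.toReal / 2)) ^ (1 / p.toReal) := by
  have : 0 < Real.Gamma (1 + p.toReal / 2) := Real.Gamma_pos_of_pos (by positivity)
  rw [gammaRoot, if_neg ht, ENNReal.ofReal_rpow_of_pos this]

theorem eventually_lt_moment_normSum {p : ℝ} (hp : 0 < p) {a : ℝ≥0∞}
    (ha : a < ENNReal.ofReal (Real.Gamma (1 + p / 2)) ^ (1 / p)) :
    ∀ᶠ d : ℕ in atTop,
      a < (∫⁻ x, ENNReal.ofReal (‖normSum d x‖ ^ p) ∂haarFin d) ^ (1 / p) := by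
  have h : a ^ p < ENNReal.ofReal (Real.Gamma (1 + p / 2)) := by
    rwa [one_div, ENNReal.lt_rpow_inv_iff hp] at ha
  filter_upwards [eventually_lt_of_lt_liminf
    (h.trans_le (gamma_le_liminf_lintegral_normSum hp.le))] with d hd
  rwa [one_div, ENNReal.lt_rpow_inv_iff hp]

theorem not_rieszBounded_of_ne_top {p q : ℝ≥0∞} {r : ℝ≥0∞} (h0 : p ≠ 0) (ht : p ≠ ∞)
    (hq : q ≠ 0) (hr : 1 ≤ r) (hrt : r ≠ ∞) (hqr : 1 / q.toReal = 1 - 1 / r.toReal)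
    (hΓ : 1 < gammaRoot p * gammaRoot r) : ¬ RieszBounded q p := by
  have hr1 : 1 ≤ r.toReal := by
    simpa using ENNReal.toReal_mono hrt hr
  have hp0 : 0 < p.toReal := ENNReal.toReal_pos h0 ht
  rw [gammaRoot_of_ne_top ht, gammaRoot_of_ne_top hrt] at hΓ
  -- Room below each factor lets the two lower limits be used separately, with a common large `d`.
  obtain ⟨a, ha, b, hb, hab⟩ : ∃ a < ENNReal.ofReal (Real.Gamma (1 + p.toReal / 2)) ^
      (1 / p.toReal), ∃ b < ENNReal.ofReal (Real.Gamma (1 + r.toReal / 2)) ^ (1 / r.toReal),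
      1 < a * b := by
    by_contra! hab
    exact hΓ.not_ge (ENNReal.mul_le_of_forall_lt hab)
  obtain ⟨d, hda, hdb, hd⟩ := ((eventually_lt_moment_normSum hp0 ha).and
    ((eventually_lt_moment_normSum (by linarith) hb).and (eventually_ge_atTop 1))).exists
  have : NeZero d := ⟨by omega⟩
  refine not_rieszBounded_of_one_lt (d := d) hr1 hq hqr h0 ht (hab.trans_le ?_)
  rw [eLpNorm_normSum h0 ht]
  exact mul_le_mul' hda.le hdb.le

theorem RieszBounded.mono {p p' q : ℝ≥0∞} (hp : p' ≤ p) (h : RieszBounded q p) :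
    RieszBounded q p' := by
  obtain ⟨C, hC⟩ := h
  exact ⟨C, fun f hf => (eLpNorm_le_eLpNorm_of_exponent_le hp
    (Lp.aestronglyMeasurable _)).trans (hC f hf)⟩

/-- The fourth power of the product is `π² / 8 > 1`. This serves the case `p = ∞`, with `4` as a
convenient finite exponent. -/
theorem one_lt_gammaRoot_four_mul_gammaRoot_one : 1 < gammaRoot 4 * gammaRoot 1 := by
  have h3 : Real.Gamma (1 + 4 / 2) = 2 := by
    rw [show (1 : ℝ) + 4 / 2 = (2 : ℕ) + 1 by norm_num, Real.Gamma_nat_eq_factorial]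
    norm_num
  have h2 : Real.Gamma (1 + 1 / 2) = √Real.pi / 2 := by
    rw [add_comm, Real.Gamma_add_one (by norm_num), Real.Gamma_one_half_eq]
    ring
  have h4 : gammaRoot 4 * gammaRoot 1 = ENNReal.ofReal (2 ^ (1 / 4 : ℝ) * (√Real.pi / 2)) := by
    rw [gammaRoot, gammaRoot, if_neg (by simp), if_neg (by simp),
      ← ENNReal.ofReal_mul (by positivity)]
    simp only [ENNReal.toReal_ofNat, ENNReal.toReal_one, h3, h2, div_one, Real.rpow_one]
  rw [h4, ENNReal.one_lt_ofReal]
  refine lt_of_pow_lt_pow_left₀ 4 (by positivity) ?_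
  have h5 : ((2 : ℝ) ^ (1 / 4 : ℝ)) ^ 4 = 2 := by
    rw [← Real.rpow_natCast, ← Real.rpow_mul zero_le_two]
    norm_num
  have h6 : √Real.pi ^ 4 = Real.pi ^ 2 := by
    rw [show 4 = 2 * 2 from rfl, pow_mul, Real.sq_sqrt Real.pi_pos.le]
  rw [mul_pow, div_pow, h5, h6]
  nlinarith [Real.pi_gt_three]

end Polytorus

end

theorem theorem3 (p q r : ENNReal) (hp : 2 ≤ p) (hpq : p ≤ q) (hr : q⁻¹ + r⁻¹ = 1)
    (hΓ : 1 < Polytorus.gammaRoot p * Polytorus.gammaRoot r) :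
    ¬ Polytorus.RieszBounded q p := by
  have hq2 : 2 ≤ q := hp.trans hpq
  have hq0 : q ≠ 0 := (two_pos.trans_le hq2).ne'
  have hr1 : 1 ≤ r := by
    rw [← ENNReal.inv_le_one]
    exact le_add_self.trans_eq hr
  have hrt : r ≠ ∞ := by
    rintro rfl
    rw [ENNReal.inv_top, add_zero, ENNReal.inv_eq_one] at hr
    rw [hr] at hq2
    norm_num at hq2
  have hqr : 1 / q.toReal = 1 - 1 / r.toReal := by
    have h := congrArg ENNReal.toReal hr
    rw [ENNReal.toReal_add (ENNReal.inv_ne_top.2 hq0)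
      (ENNReal.inv_ne_top.2 (one_pos.trans_le hr1).ne'), ENNReal.toReal_inv, ENNReal.toReal_inv,
      ENNReal.toReal_one] at h
    rw [one_div, one_div]
    linarith
  rcases eq_or_ne p ∞ with rfl | hpt
  -- On a probability space boundedness into `L^∞` implies boundedness into `L^4`, which fails for
  -- `q = ∞`, `r = 1`.
  · obtain rfl : q = ∞ := top_le_iff.1 hpq
    obtain rfl : r = 1 := by simpa using hr
    exact fun h => Polytorus.not_rieszBounded_of_ne_top (p := 4) (by simp) (by simp) hq0 le_rfl
      (by simp) hqr Polytorus.one_lt_gammaRoot_four_mul_gammaRoot_one (h.mono le_top)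
  · exact Polytorus.not_rieszBounded_of_ne_top (two_pos.trans_le hp).ne' hpt hq0 hr1 hrt hqr hΓ
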